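/- Let $n\ge 0$, let $A$ be a real $n\times n$ matrix and $B\in\mathbb R^n$, and suppose that the linear system $\frac{dx}{dt}=Ax+Bw$ is controllable: for all $p_0,p_1\in\mathbb R^n$ there are a time $T\ge 0$ and a smooth scalar control $w$ on $[0,T]$ steering $p_0$ to $p_1$ in time $T$. For every $T_0>0$ there is a constant $\kappa>0$ (depending only on $A$, $B$ and $T_0$) such that, for every smooth $f:\mathbb R^n\to\mathbb R^n$ with $\|Df(x)\|<\kappa$ for all $x\in\mathbb R^n$ (operator norm induced by the Euclidean norm), the following hold. 1. $\det\big[B,\ (A+Df(x))B,\ \ldots,\ (A+Df(x))^{n-1}B\big]\neq 0$ for all $x\in\mathbb R^n$. 2. For every final time $T\ge T_0$, the system $\frac{dx}{dt}=Ax+Bw+f(x)$ is locally controllable with final time $T$. That is, for every initial state $x_0$ the end-point map $V_T[\,\cdot\,,x_0]$, which sends a control $w$ to the value $x(T)$ of the solution with $x(0)=x_0$, is defined on all smooth controls $w:[0,T]\to\mathbb R$, and no control is singular: for each smooth $w$ the directional derivatives $\delta w\mapsto \frac{d}{d\varepsilon}\big|_{\varepsilon=0}V_T[w+\varepsilon\,\delta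 w,x_0]$ exist for all smooth $\delta w$ and form a linear map onto $\mathbb R^n$. -/

import Mathlib

open Set
open scoped ContDiff

noncomputable section

/-- The smooth scalar controls on the time interval `[0, T]`. -/
def smoothControls (T : ℝ) : Submodule ℝ (ℝ → ℝ) where
  carrier := {w | ContDiffOn ℝ ∞ w (Icc 0 T)}
  add_mem' hu hv := ContDiffOn.add hu hv
  zero_mem' := contDiffOn_const
  smul_mem' c _ hw := ContDiffOn.const_smul c hw

section ControlSystem

variable {E : Type*} [NormedAddCommGroup E] [NormedSpace ℝ E]

/-- `x` solves `dx/dt = F(x(t), w(t))` on `[0, T]` with `x(0) = x₀` (one-sided derivatives at the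
end points of the interval). -/
def IsTrajectory (F : E → ℝ → E) (T : ℝ) (w : ℝ → ℝ) (x₀ : E) (x : ℝ → E) : Prop :=
  x 0 = x₀ ∧ ∀ t ∈ Icc 0 T, HasDerivWithinAt x (F (x t) (w t)) (Icc 0 T) t

open Classical in
/-- The end-point map `V_T[w, x₀] = x(T)`, where `x` is the trajectory with control `w` that starts
at `x₀` (the value is `0` if there is no trajectory on `[0, T]`). -/
def endPoint (F : E → ℝ → E) (T : ℝ) (w : ℝ → ℝ) (x₀ : E) : E :=
  if h : ∃ x, IsTrajectory F T w x₀ x then h.choose T else 0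

/-- Global controllability: any state can be steered to any other state, in some time `T`, by some
smooth control on `[0, T]`. -/
def IsGloballyControllable (F : E → ℝ → E) : Prop :=
  ∀ p₀ p₁ : E, ∃ T : ℝ, 0 ≤ T ∧ ∃ w ∈ smoothControls T, ∃ x : ℝ → E,
    IsTrajectory F T w p₀ x ∧ x T = p₁

/-- The linear map `L` on the space of smooth control variations is the differential at `w` of the
end-point map `w ↦ V_T[w, x₀]`: `L δw` is the derivative of `ε ↦ V_T[w + ε δw, x₀]` at `ε = 0`. -/
def IsEndPointDifferential (F : E → ℝ → E) (T : ℝ) (x₀ : E) (w : smoothControls T)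
    (L : smoothControls T →ₗ[ℝ] E) : Prop :=
  ∀ δw : smoothControls T,
    HasDerivAt (fun ε : ℝ => endPoint F T (w + ε • δw : smoothControls T) x₀) (L δw) 0

/-- The control `w` is regular (not singular): the end-point map has a differential at `w`, and
this differential is onto the tangent space `E` of the state space. -/
def IsRegularControl (F : E → ℝ → E) (T : ℝ) (x₀ : E) (w : smoothControls T) : Prop :=
  ∃ L : smoothControls T →ₗ[ℝ] E, IsEndPointDifferential F T x₀ w L ∧ Function.Surjective L

/-- Local controllability (local surjectivity) with final time `T`: for every initial state the
end-point map is defined on all smooth controls on `[0, T]`, and no control is singular. -/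
def IsLocallyControllable (F : E → ℝ → E) (T : ℝ) : Prop :=
  ∀ (x₀ : E) (w : smoothControls T),
    (∃ x, IsTrajectory F T w x₀ x) ∧ IsRegularControl F T x₀ w

end ControlSystem

/-- The Kalman matrix `[B, M B, …, M ^ (n - 1) B]`, whose `j`-th column is `M ^ j B`. -/
def kalmanMatrix {n : ℕ} (M : EuclideanSpace ℝ (Fin n) →L[ℝ] EuclideanSpace ℝ (Fin n))
    (B : EuclideanSpace ℝ (Fin n)) : Matrix (Fin n) (Fin n) ℝ :=
  Matrix.of fun i j => ((M ^ (j : ℕ)) B) i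

end

/-! The differential of the end-point map at `w` sends `u` to `z T`, where `z' = (A + Df(x))z + uB`
and `z 0 = 0`. A vector `p` orthogonal to its range, propagated backwards from time `T` by the
adjoint equation, gives `r` with `r 0 = p` and `⟪B, r s⟫ = 0` on `[0, T]`
(`exists_adjoint_solution`). For small `Df`, Gronwall puts `r s` within `Cκ‖p‖` of `exp (s • A*) p`,
while observability of the unperturbed adjoint gives `‖p‖ ≤ c · sup |⟪B, exp (s • A*) p⟫|`; so `p =
0` once `c‖B‖Cκ < 1` (`exists_pos_forall_eq_zero_of_inner_eq_zero`). Only reversed times in `[0,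
T₀]` are used, hence one `κ` serves all `T ≥ T₀`. Observability comes from the Kalman condition,
which controllability implies. The determinant claim then follows by continuity of the Kalman
determinant at `A`. -/

/-! ### Existence, uniqueness and stability for Lipschitz ODEs on a closed interval. -/

open Metric in
theorem exists_solution_short_Icc {E : Type*} [NormedAddCommGroup E] [NormedSpace ℝ E]
    [CompleteSpace E] {v : ℝ → E → E} {K : NNReal} {a b : ℝ} (hab : a ≤ b)
    (hlen : 2 * K * (b - a) ≤ 1) (hv : ∀ t ∈ Icc a b, LipschitzWith K (v t))
    (hc : ∀ x, ContinuousOn (v · x) (Icc a b)) (x₀ : E) :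
    ∃ x : ℝ → E, x a = x₀ ∧ ∀ t ∈ Icc a b, HasDerivWithinAt x (v t (x t)) (Icc a b) t := by
  obtain ⟨C, hC⟩ := isCompact_Icc.exists_bound_of_continuousOn (hc x₀)
  have hC0 : 0 ≤ C := (norm_nonneg _).trans (hC a (left_mem_Icc.2 hab))
  have hba : 0 ≤ b - a := sub_nonneg.2 hab
  lift C to NNReal using hC0
  obtain ⟨h, hh⟩ : ∃ h : NNReal, (h : ℝ) = b - a := ⟨⟨_, hba⟩, rfl⟩
  -- On the ball of radius `2Ch` about `x₀` the field is bounded by `C + 2KCh ≤ 2C`, because `2Kh ≤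
  -- 1`; so in time `h` no curve leaves the ball.
  have hpl : IsPicardLindelof v (⟨a, left_mem_Icc.2 hab⟩ : Icc a b) x₀ (2 * C * h) 0
      (C + K * (2 * C * h)) K := by
    refine ⟨fun t ht => (hv t ht).lipschitzOnWith, fun x _ => hc x, fun t ht x hx => ?_, ?_⟩
    · have h1 := (hv t ht).dist_le_mul x x₀
      rw [mem_closedBall] at hx
      have h2 : ‖v t x‖ ≤ ‖v t x₀‖ + dist (v t x) (v t x₀) := by
        rw [dist_eq_norm]; exact norm_le_norm_add_norm_sub' _ _
      push_cast at hx ⊢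
      have h3 := mul_le_mul_of_nonneg_left hx K.coe_nonneg
      linarith [hC t ht]
    · simp only [sub_self, max_eq_left hba]
      push_cast
      rw [← hh] at hlen ⊢
      have : 0 ≤ (C : ℝ) * h := by positivity
      nlinarith
  exact hpl.exists_eq_forall_mem_Icc_hasDerivWithinAt₀

theorem exists_solution_glue {E : Type*} [NormedAddCommGroup E] [NormedSpace ℝ E]
    {v : ℝ → E → E} {a b c : ℝ} (hab : a ≤ b) (hbc : b ≤ c) {x y : ℝ → E}
    (hx : ∀ t ∈ Icc a b, HasDerivWithinAt x (v t (x t)) (Icc a b) t)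
    (hy : ∀ t ∈ Icc b c, HasDerivWithinAt y (v t (y t)) (Icc b c) t) (hxy : x b = y b) :
    ∃ z : ℝ → E, z a = x a ∧ ∀ t ∈ Icc a c, HasDerivWithinAt z (v t (z t)) (Icc a c) t := by
  set z : ℝ → E := fun t => if t ≤ b then x t else y t with hz
  have zx : ∀ t ∈ Icc a b, z t = x t := fun t ht => if_pos ht.2
  have zy : ∀ t ∈ Icc b c, z t = y t := fun t ht => by
    rcases ht.1.eq_or_lt with rfl | h
    · simp [hz, hxy]
    · exact if_neg (not_le.2 h)
  refine ⟨z, zx a (left_mem_Icc.2 hab), fun t ht => ?_⟩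
  have h1 : t ≤ b → HasDerivWithinAt z (v t (z t)) (Icc a b) t := fun h => by
    rw [zx t ⟨ht.1, h⟩]
    exact (hx t ⟨ht.1, h⟩).congr zx (zx t ⟨ht.1, h⟩)
  have h2 : b ≤ t → HasDerivWithinAt z (v t (z t)) (Icc b c) t := fun h => by
    rw [zy t ⟨h, ht.2⟩]
    exact (hy t ⟨h, ht.2⟩).congr zy (zy t ⟨h, ht.2⟩)
  rcases lt_trichotomy t b with h | h | h
  · refine (h1 h.le).mono_of_mem_nhdsWithin ?_
    rw [mem_nhdsWithin]
    exact ⟨Iio b, isOpen_Iio, h, fun s hs => ⟨hs.2.1, le_of_lt hs.1⟩⟩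
  · rw [← Icc_union_Icc_eq_Icc hab hbc]
    exact (h1 h.le).union (h2 h.ge)
  · refine (h2 h.le).mono_of_mem_nhdsWithin ?_
    rw [mem_nhdsWithin]
    exact ⟨Ioi b, isOpen_Ioi, h, fun s hs => ⟨le_of_lt hs.1, hs.2.2⟩⟩

/-- Global existence for a vector field that is Lipschitz in space, uniformly in time. -/
theorem exists_solution_Icc {E : Type*} [NormedAddCommGroup E] [NormedSpace ℝ E]
    [CompleteSpace E] {v : ℝ → E → E} {K : NNReal} {T : ℝ} (hT : 0 ≤ T)
    (hv : ∀ t ∈ Icc 0 T, LipschitzWith K (v t))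
    (hc : ∀ x, ContinuousOn (v · x) (Icc 0 T)) (x₀ : E) :
    ∃ x : ℝ → E, x 0 = x₀ ∧ ∀ t ∈ Icc 0 T, HasDerivWithinAt x (v t (x t)) (Icc 0 T) t := by
  obtain ⟨N, hN⟩ := exists_nat_gt (2 * K * T)
  have hN0 : (0 : ℝ) < N := lt_of_le_of_lt (by positivity) hN
  have key : ∀ k : ℕ, k ≤ N → ∃ x : ℝ → E, x 0 = x₀ ∧
      ∀ t ∈ Icc 0 (k * (T / N)), HasDerivWithinAt x (v t (x t)) (Icc 0 (k * (T / N))) t := by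
    intro k
    induction k with
    | zero =>
      intro _
      refine ⟨fun _ => x₀, rfl, fun t ht => ?_⟩
      simp only [Nat.cast_zero, zero_mul, Icc_self, mem_singleton_iff] at ht ⊢
      subst ht
      -- Within a one-point set every vector is a derivative.
      exact hasDerivWithinAt_iff_hasFDerivWithinAt.2 HasFDerivWithinAt.singleton
    | succ k ih =>
      intro hk
      obtain ⟨x, hx0, hx⟩ := ih (by omega)
      have hd : 0 ≤ T / N := by positivity
      have hle : (k : ℝ) * (T / N) ≤ (k + 1 : ℕ) * (T / N) := by
        push_cast; nlinarith
      have h0 : 0 ≤ (k : ℝ) * (T / N) := by positivity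
      have hsub : Icc ((k : ℝ) * (T / N)) ((k + 1 : ℕ) * (T / N)) ⊆ Icc 0 T := by
        refine Icc_subset_Icc h0 ?_
        have : ((k + 1 : ℕ) : ℝ) ≤ N := by exact_mod_cast hk
        calc ((k + 1 : ℕ) : ℝ) * (T / N) ≤ N * (T / N) := by gcongr
          _ = T := by field_simp
      obtain ⟨y, hy0, hy⟩ := exists_solution_short_Icc (v := v) (K := K) hle
        (by
          have : ((k + 1 : ℕ) : ℝ) * (T / N) - k * (T / N) = T / N := by push_cast; ring
          rw [this, ← mul_div_assoc, div_le_one hN0]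
          exact hN.le)
        (fun t ht => hv t (hsub ht)) (fun x => (hc x).mono hsub) (x ((k : ℝ) * (T / N)))
      obtain ⟨z, hz0, hz⟩ := exists_solution_glue h0 hle hx hy hy0.symm
      exact ⟨z, hz0.trans hx0, hz⟩
  obtain ⟨x, hx0, hx⟩ := key N le_rfl
  rw [mul_div_cancel₀ _ hN0.ne'] at hx
  exact ⟨x, hx0, hx⟩

/-- Gronwall's inequality comparing a solution with an approximate solution, both given by
derivatives within `Icc 0 T`. -/
theorem norm_sub_le_of_approx_solution {E : Type*} [NormedAddCommGroup E] [NormedSpace ℝ E]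
    {v : ℝ → E → E} {K : NNReal} {T : ℝ} (hv : ∀ t ∈ Icc 0 T, LipschitzWith K (v t))
    {x y y' : ℝ → E} {δ : ℝ} (hxy : x 0 = y 0)
    (hx : ∀ t ∈ Icc 0 T, HasDerivWithinAt x (v t (x t)) (Icc 0 T) t)
    (hy : ∀ t ∈ Icc 0 T, HasDerivWithinAt y (y' t) (Icc 0 T) t)
    (hδ : ∀ t ∈ Icc 0 T, ‖y' t - v t (y t)‖ ≤ δ) :
    ∀ t ∈ Icc 0 T, ‖x t - y t‖ ≤ δ * gronwallBound 0 K 1 T := by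
  intro t ht
  have hδ0 : 0 ≤ δ := (norm_nonneg _).trans (hδ t ht)
  have h := dist_le_of_approx_trajectories_ODE_of_mem (v := v) (s := fun _ => univ) (K := K)
    (f := x) (g := y) (f' := fun t => v t (x t)) (g' := y') (a := 0) (b := T)
    (εf := 0) (εg := δ) (δ := 0) (fun t ht => (hv t (Ico_subset_Icc_self ht)).lipschitzOnWith)
    (fun t ht => (hx t ht).continuousWithinAt)
    (fun t ht => (hx t (Ico_subset_Icc_self ht)).mono_of_mem_nhdsWithin (Icc_mem_nhdsGE_of_mem ht))
    (fun t _ => by simp) (fun _ _ => mem_univ _)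
    (fun t ht => (hy t ht).continuousWithinAt)
    (fun t ht => (hy t (Ico_subset_Icc_self ht)).mono_of_mem_nhdsWithin (Icc_mem_nhdsGE_of_mem ht))
    (fun t ht => by rw [dist_eq_norm]; exact hδ t (Ico_subset_Icc_self ht)) (fun _ _ => mem_univ _)
    (by simp [hxy]) t ht
  rw [dist_eq_norm, zero_add, sub_zero] at h
  refine h.trans ((gronwallBound_mono le_rfl hδ0 K.coe_nonneg ht.2).trans (le_of_eq ?_))
  -- `gronwallBound 0 K δ T` is linear in `δ`, but its closed form differs for `K = 0`.
  by_cases hK : (K : ℝ) = 0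
  · simp [hK, gronwallBound_K0]
  · simp [gronwallBound_of_K_ne_0 hK]; ring

theorem solution_unique_Icc {E : Type*} [NormedAddCommGroup E] [NormedSpace ℝ E]
    {v : ℝ → E → E} {K : NNReal} {T : ℝ} (hv : ∀ t ∈ Icc 0 T, LipschitzWith K (v t))
    {x y : ℝ → E} (hxy : x 0 = y 0)
    (hx : ∀ t ∈ Icc 0 T, HasDerivWithinAt x (v t (x t)) (Icc 0 T) t)
    (hy : ∀ t ∈ Icc 0 T, HasDerivWithinAt y (v t (y t)) (Icc 0 T) t) :
    ∀ t ∈ Icc 0 T, x t = y t := by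
  intro t ht
  have h := norm_sub_le_of_approx_solution hv hxy hx hy (δ := 0) (by simp) t ht
  rw [zero_mul] at h
  exact sub_eq_zero.1 (norm_le_zero_iff.1 h)

/-- Uniqueness makes the choice of trajectory in `endPoint` immaterial. -/
theorem endPoint_eq {E : Type*} [NormedAddCommGroup E] [NormedSpace ℝ E]
    {F : E → ℝ → E} {K : NNReal} (hF : ∀ u, LipschitzWith K (F · u)) {T : ℝ} (hT : 0 ≤ T)
    {w : ℝ → ℝ} {x₀ : E} {x : ℝ → E} (hx : IsTrajectory F T w x₀ x) :
    endPoint F T w x₀ = x T := by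
  have h : ∃ x, IsTrajectory F T w x₀ x := ⟨x, hx⟩
  rw [endPoint, dif_pos h]
  exact solution_unique_Icc (v := fun t x => F x (w t)) (fun t _ => hF (w t))
    (h.choose_spec.1.trans hx.1.symm) h.choose_spec.2 hx.2 T (right_mem_Icc.2 hT)

/-! ### Controllability, observability and its robustness for linear systems. -/

section LinearSystem

open NormedSpace ContinuousLinearMap
open scoped RealInnerProductSpace

variable {E : Type*} [NormedAddCommGroup E] [InnerProductSpace ℝ E] [FiniteDimensional ℝ E]

theorem inner_exp_smul_apply_eq_zero {A : E →L[ℝ] E} {B p : E} (h : ∀ j : ℕ, ⟪p, (A ^ j) B⟫ = 0)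
    (s : ℝ) : ⟪p, exp (s • A) B⟫ = 0 := by
  have : CompleteSpace E := FiniteDimensional.complete ℝ E
  have h1 := exp_series_hasSum_exp' (𝕂 := ℝ) (s • A)
  have h2 := ((innerSL ℝ p).comp (ContinuousLinearMap.apply ℝ E B)).hasSum h1
  have h3 : HasSum (fun _ : ℕ => (0 : ℝ)) ⟪p, exp (s • A) B⟫ := by
    refine h2.congr_fun ?_
    intro j
    change 0 = ⟪p, ((j.factorial⁻¹ : ℝ) • (s • A) ^ j) B⟫
    rw [smul_pow, smul_apply, smul_apply, inner_smul_right, inner_smul_right, h j, mul_zero,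
      mul_zero]
  exact h3.unique hasSum_zero

/-- In a controllable linear system the vectors `A ^ j B` span the state space. -/
theorem IsGloballyControllable.eq_zero_of_inner_pow_eq_zero {A : E →L[ℝ] E} {B : E}
    (hAB : IsGloballyControllable (fun (x : E) (w : ℝ) => A x + w • B)) {p : E}
    (h : ∀ j : ℕ, ⟪p, (A ^ j) B⟫ = 0) : p = 0 := by
  have : CompleteSpace E := FiniteDimensional.complete ℝ E
  obtain ⟨T, hT, w, -, x, ⟨hx0, hx⟩, hxT⟩ := hAB 0 p
  have hexp : ∀ t : ℝ, HasDerivAt (fun t : ℝ => exp ((T - t) • A))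
      (-(exp ((T - t) • A) * A)) t := fun t => by
    have := (hasDerivAt_exp_smul_const (𝕂 := ℝ) A (T - t)).scomp t ((hasDerivAt_id t).const_sub T)
    rwa [neg_one_smul] at this
  -- The terms in `A` cancel, leaving `w t * ⟪p, exp ((T - t) • A) B⟫ = 0`. The constant function is
  -- `0` at time `0` and `⟪p, p⟫` at time `T`.
  have hd : ∀ t ∈ Icc 0 T, HasDerivWithinAt (fun t => ⟪p, exp ((T - t) • A) (x t)⟫) 0
      (Icc 0 T) t := by
    intro t ht
    have h1 := (hexp t).hasDerivWithinAt.clm_apply (hx t ht)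
    have h2 := (hasDerivWithinAt_const t (Icc 0 T) p).inner ℝ h1
    refine h2.congr_deriv ?_
    simp [inner_smul_right, inner_exp_smul_apply_eq_zero h]
  have hconst := constant_of_derivWithin_zero (fun t ht => (hd t ht).differentiableWithinAt)
    (fun t ht => (hd t (Ico_subset_Icc_self ht)).derivWithin
      (uniqueDiffOn_Icc (lt_of_le_of_lt ht.1 ht.2) t (Ico_subset_Icc_self ht)))
    T (right_mem_Icc.2 hT)
  simpa [hx0, hxT] using hconst

/-- Differentiate the identity `j` times on the open interval, then let `s → 0` by continuity. -/
theorem inner_pow_eq_zero_of_inner_exp_eq_zero {M : E →L[ℝ] E} {B p : E} {T : ℝ} (hT : 0 < T)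
    (h : ∀ s ∈ Icc 0 T, ⟪B, exp (s • M) p⟫ = 0) (j : ℕ) : ⟪B, (M ^ j) p⟫ = 0 := by
  have : CompleteSpace E := FiniteDimensional.complete ℝ E
  have hd : ∀ (j : ℕ) (s : ℝ), HasDerivAt (fun s : ℝ => ⟪B, (M ^ j) (exp (s • M) p)⟫)
      ⟪B, (M ^ (j + 1)) (exp (s • M) p)⟫ s := fun j s => by
    have h1 := (hasDerivAt_exp_smul_const' (𝕂 := ℝ) M s).clm_apply (hasDerivAt_const s p)
    have h2 := (hasDerivAt_const s B).inner ℝ ((M ^ j).hasFDerivAt.comp_hasDerivAt s h1)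
    refine h2.congr_deriv ?_
    simp [pow_succ]
  have hI : ∀ j : ℕ, ∀ s ∈ Ioo 0 T, ⟪B, (M ^ j) (exp (s • M) p)⟫ = 0 := by
    intro j
    induction j with
    | zero => exact fun s hs => by simpa using h s (Ioo_subset_Icc_self hs)
    | succ j ih =>
      intro s hs
      refine (hd j s).unique ((hasDerivAt_const s (0 : ℝ)).congr_of_eventuallyEq ?_)
      filter_upwards [isOpen_Ioo.mem_nhds hs] with u hu using ih u hu
  have hcl : EqOn (fun s : ℝ => ⟪B, (M ^ j) (exp (s • M) p)⟫) (fun _ => 0) (closure (Ioo 0 T)) :=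
    EqOn.closure (hI j) (continuous_iff_continuousAt.2 fun s => (hd j s).continuousAt)
      continuous_const
  rw [closure_Ioo hT.ne] at hcl
  simpa using hcl (left_mem_Icc.2 hT.le)

/-- Quantitative observability of the adjoint system. -/
theorem exists_mul_norm_le_of_inner_exp_le {M : E →L[ℝ] E} {B : E}
    (h : ∀ p : E, (∀ j : ℕ, ⟪B, (M ^ j) p⟫ = 0) → p = 0) {T : ℝ} (hT : 0 < T) :
    ∃ c : ℝ, 0 < c ∧ ∀ (p : E) (m : ℝ), 0 ≤ m →
      (∀ s ∈ Icc 0 T, |⟪B, exp (s • M) p⟫| ≤ m) → ‖p‖ ≤ c * m := by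
  have : CompleteSpace E := FiniteDimensional.complete ℝ E
  have hc : Continuous fun s : ℝ => exp (s • M) := continuous_iff_continuousAt.2 fun s =>
    (hasDerivAt_exp_smul_const (𝕂 := ℝ) M s).continuousAt
  -- The observation map is injective on a finite-dimensional space, hence bounded below; `c` is its
  -- antilipschitz constant.
  let Φ : E →ₗ[ℝ] C(Icc 0 T, ℝ) :=
    { toFun := fun p => ⟨fun s => ⟪B, exp ((s : ℝ) • M) p⟫,
        continuous_const.inner ((hc.comp continuous_subtype_val).clm_apply continuous_const)⟩
      map_add' := fun p q => by ext s; simp [inner_add_right]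
      map_smul' := fun a p => by ext s; simp [inner_smul_right] }
  have hker : LinearMap.ker Φ = ⊥ := by
    rw [LinearMap.ker_eq_bot']
    intro p hp
    refine h p (inner_pow_eq_zero_of_inner_exp_eq_zero hT fun s hs => ?_)
    exact DFunLike.congr_fun hp ⟨s, hs⟩
  obtain ⟨K, hK, hΦ⟩ := Φ.exists_antilipschitzWith hker
  refine ⟨K, hK, fun p m hm hp => ?_⟩
  have h1 := hΦ.le_mul_dist p 0
  rw [map_zero, dist_zero_right, dist_zero_right] at h1
  refine h1.trans (mul_le_mul_of_nonneg_left ?_ K.coe_nonneg)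
  exact (ContinuousMap.norm_le _ hm).2 fun s => hp s s.2

/-- The curve `exp (s • M) (r 0)` solves the perturbed equation up to the defect `D s (exp (s • M)
(r 0))`, so Gronwall applies. Requiring `κ ≤ 1` fixes the Lipschitz constant `‖M‖ + 1`, which keeps
`C` independent of `κ` and `D`. -/
theorem exists_norm_sub_exp_le (M : E →L[ℝ] E) {T : ℝ} (hT : 0 ≤ T) :
    ∃ C : ℝ, 0 ≤ C ∧ ∀ (κ : ℝ) (D : ℝ → E →L[ℝ] E) (r : ℝ → E), κ ≤ 1 →
      (∀ s ∈ Icc 0 T, ‖D s‖ ≤ κ) →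
      (∀ s ∈ Icc 0 T, HasDerivWithinAt r ((M + D s) (r s)) (Icc 0 T) s) →
      ∀ s ∈ Icc 0 T, ‖r s - exp (s • M) (r 0)‖ ≤ C * κ * ‖r 0‖ := by
  have : CompleteSpace E := FiniteDimensional.complete ℝ E
  have hc : Continuous fun s : ℝ => exp (s • M) := continuous_iff_continuousAt.2 fun s =>
    (hasDerivAt_exp_smul_const (𝕂 := ℝ) M s).continuousAt
  obtain ⟨C, hC⟩ := (isCompact_Icc (a := (0 : ℝ)) (b := T)).exists_bound_of_continuousOn
    hc.continuousOn
  have hC0 : 0 ≤ C := (norm_nonneg _).trans (hC 0 (left_mem_Icc.2 hT))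
  have hG : 0 ≤ gronwallBound 0 (‖M‖₊ + 1 : NNReal) 1 T := by
    have := gronwallBound_mono (δ := 0) (ε := 1) le_rfl zero_le_one
      (NNReal.coe_nonneg (‖M‖₊ + 1)) hT
    rwa [gronwallBound_x0] at this
  refine ⟨C * gronwallBound 0 (‖M‖₊ + 1 : NNReal) 1 T, mul_nonneg hC0 hG, ?_⟩
  intro κ D r hκ hD hr s hs
  have h1 := norm_sub_le_of_approx_solution (v := fun s x => (M + D s) x) (K := ‖M‖₊ + 1)
    (x := r) (y := fun s => exp (s • M) (r 0)) (y' := fun s => M (exp (s • M) (r 0)))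
    (δ := κ * (C * ‖r 0‖)) (T := T)
    (fun t ht => by
      refine (M + D t).lipschitz.weaken ?_
      rw [← NNReal.coe_le_coe]
      push_cast
      exact (norm_add_le _ _).trans (by linarith [hD t ht]))
    (by simp) hr
    (fun t _ => by
      have := ((hasDerivAt_exp_smul_const' (𝕂 := ℝ) M t).clm_apply
        (hasDerivAt_const t (r 0))).hasDerivWithinAt (s := Icc 0 T)
      simpa using this)
    (fun t ht => by
      have h2 : M (exp (t • M) (r 0)) - (M + D t) (exp (t • M) (r 0))
          = -(D t (exp (t • M) (r 0))) := by simp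
      rw [h2, norm_neg]
      exact (D t).le_of_opNorm_le_of_le (hD t ht) ((exp (t • M)).le_of_opNorm_le (hC t ht) _))
    s hs
  exact h1.trans (le_of_eq (by ring))

/-- Unique continuation for small time-dependent perturbations of an observable system. -/
theorem exists_pos_forall_eq_zero_of_inner_eq_zero {M : E →L[ℝ] E} {B : E}
    (h : ∀ p : E, (∀ j : ℕ, ⟪B, (M ^ j) p⟫ = 0) → p = 0) {T : ℝ} (hT : 0 < T) :
    ∃ κ : ℝ, 0 < κ ∧ ∀ (D : ℝ → E →L[ℝ] E) (r : ℝ → E),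
      (∀ s ∈ Icc 0 T, ‖D s‖ ≤ κ) →
      (∀ s ∈ Icc 0 T, HasDerivWithinAt r ((M + D s) (r s)) (Icc 0 T) s) →
      (∀ s ∈ Icc 0 T, ⟪B, r s⟫ = 0) → r 0 = 0 := by
  obtain ⟨c, hc, hobs⟩ := exists_mul_norm_le_of_inner_exp_le h hT
  obtain ⟨C, hC, hcmp⟩ := exists_norm_sub_exp_le M hT.le
  have hpos : 0 < c * (‖B‖ * C) + 1 := by positivity
  have hle : 1 ≤ c * (‖B‖ * C) + 1 := le_add_of_nonneg_left (by positivity)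
  -- With this `κ`, `c‖B‖Cκ = 1 - κ < 1`, so the estimate absorbs into `‖r 0‖`.
  refine ⟨(c * (‖B‖ * C) + 1)⁻¹, inv_pos.2 hpos, fun D r hD hr h0 => ?_⟩
  set κ := (c * (‖B‖ * C) + 1)⁻¹ with hκ
  have hκ0 : 0 < κ := inv_pos.2 hpos
  have h1 := hcmp κ D r (inv_le_one_of_one_le₀ hle) hD hr
  have h2 := hobs (r 0) (‖B‖ * (C * κ * ‖r 0‖)) (by positivity) fun s hs => by
    have h3 : ⟪B, exp (s • M) (r 0)⟫ = -⟪B, r s - exp (s • M) (r 0)⟫ := by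
      rw [inner_sub_right, h0 s hs]; ring
    rw [h3, abs_neg]
    exact (abs_real_inner_le_norm _ _).trans
      (mul_le_mul_of_nonneg_left (h1 s hs) (norm_nonneg _))
  have h4 : (c * (‖B‖ * C) + 1) * κ = 1 := mul_inv_cancel₀ hpos.ne'
  have h5 : ‖r 0‖ * κ ≤ 0 := by
    have : c * (‖B‖ * (C * κ * ‖r 0‖)) = ‖r 0‖ * (1 - κ) := by rw [← h4]; ring
    linarith
  exact norm_le_zero_iff.1 (nonpos_of_mul_nonpos_left h5 hκ0)

end LinearSystem

/-! ### The Kalman determinant. -/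

section Kalman

open scoped RealInnerProductSpace

/-- A singular matrix has a nonzero left null vector, orthogonal to `A ^ j B` for `j < n`;
Cayley–Hamilton extends this to all `j`. -/
theorem kalmanMatrix_det_ne_zero {n : ℕ}
    {A : EuclideanSpace ℝ (Fin n) →L[ℝ] EuclideanSpace ℝ (Fin n)} {B : EuclideanSpace ℝ (Fin n)}
    (h : ∀ p : EuclideanSpace ℝ (Fin n), (∀ j : ℕ, ⟪p, (A ^ j) B⟫ = 0) → p = 0) :
    (kalmanMatrix A B).det ≠ 0 := by
  intro hdet
  obtain ⟨c, hc, hcK⟩ := Matrix.exists_vecMul_eq_zero_iff.2 hdet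
  have hp : ∀ j < n, ⟪(WithLp.toLp 2 c : EuclideanSpace ℝ (Fin n)), (A ^ j) B⟫ = 0 := by
    intro j hj
    have := congrFun hcK ⟨j, hj⟩
    simpa [Matrix.vecMul, dotProduct, kalmanMatrix, PiLp.inner_apply, mul_comm] using this
  -- The strict degree bound for the remainder needs a characteristic polynomial other than `1`.
  have hn : n ≠ 0 := by
    rintro rfl
    exact hc (Subsingleton.elim _ _)
  refine hc ((WithLp.toLp_injective 2) (h (WithLp.toLp 2 c) fun k => ?_))
  have h1 := LinearMap.pow_eq_aeval_mod_charpoly (A : EuclideanSpace ℝ (Fin n) →ₗ[ℝ] _) k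
  have hdeg : ((Polynomial.X ^ k : Polynomial ℝ) %ₘ
      (A : EuclideanSpace ℝ (Fin n) →ₗ[ℝ] _).charpoly).natDegree < n := by
    have h2 := Polynomial.natDegree_modByMonic_lt (Polynomial.X ^ k : Polynomial ℝ)
      (LinearMap.charpoly_monic (A : EuclideanSpace ℝ (Fin n) →ₗ[ℝ] _))
      (fun h => by
        have := congrArg Polynomial.natDegree h
        rw [LinearMap.charpoly_natDegree] at this
        simp [hn] at this)
    rwa [LinearMap.charpoly_natDegree, finrank_euclideanSpace_fin] at h2
  rw [Polynomial.aeval_eq_sum_range' hdeg] at h1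
  have hpow : ∀ j, (A ^ j) B = ((A : EuclideanSpace ℝ (Fin n) →ₗ[ℝ] _) ^ j) B := fun j => by
    rw [← ContinuousLinearMap.toLinearMap_pow]; rfl
  rw [hpow, h1, LinearMap.sum_apply, inner_sum]
  refine Finset.sum_eq_zero fun j hj => ?_
  rw [LinearMap.smul_apply, inner_smul_right, ← hpow, hp j (Finset.mem_range.1 hj), mul_zero]

theorem continuous_kalmanMatrix_det {n : ℕ} (B : EuclideanSpace ℝ (Fin n)) :
    Continuous fun M : EuclideanSpace ℝ (Fin n) →L[ℝ] EuclideanSpace ℝ (Fin n) =>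
      (kalmanMatrix M B).det := by
  refine Continuous.matrix_det (continuous_matrix fun i j => ?_)
  simp only [kalmanMatrix, Matrix.of_apply]
  fun_prop

end Kalman

/-! ### Linearization of the end-point map of the perturbed system. -/

section Perturbation

open Filter Topology Metric
open scoped RealInnerProductSpace

section Normed

variable {E : Type*} [NormedAddCommGroup E] [NormedSpace ℝ E]

theorem exists_lipschitzWith_controlSystem (A : E →L[ℝ] E) (B : E) {f : E → E} {κ : ℝ}
    (hf : Differentiable ℝ f) (hκ : ∀ x, ‖fderiv ℝ f x‖ ≤ κ) :
    ∃ K : NNReal, ∀ u : ℝ, LipschitzWith K (fun x => A x + u • B + f x) := by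
  have hκ0 : 0 ≤ κ := (norm_nonneg _).trans (hκ 0)
  lift κ to NNReal using hκ0
  exact ⟨‖A‖₊ + 0 + κ, fun u => (A.lipschitz.add (LipschitzWith.const _)).add
    (lipschitzWith_of_nnnorm_fderiv_le hf hκ)⟩

/-- First-order Taylor expansion along a curve, uniformly in time. -/
theorem eventually_norm_taylor_le [FiniteDimensional ℝ E] {f : E → E} (hf : ContDiff ℝ 1 f)
    {T : ℝ} (hT : 0 ≤ T) {x z : ℝ → E} (hx : ContinuousOn x (Icc 0 T))
    (hz : ContinuousOn z (Icc 0 T)) {η : ℝ} (hη : 0 < η) :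
    ∀ᶠ ε : ℝ in 𝓝 0, ∀ t ∈ Icc 0 T,
      ‖f (x t + ε • z t) - f (x t) - ε • fderiv ℝ f (x t) (z t)‖ ≤ η * |ε| := by
  have : ProperSpace E := FiniteDimensional.proper ℝ E
  obtain ⟨R, hR⟩ := isCompact_Icc.exists_bound_of_continuousOn hx
  obtain ⟨Z, hZ⟩ := isCompact_Icc.exists_bound_of_continuousOn hz
  have hZ0 : 0 ≤ Z := (norm_nonneg _).trans (hZ 0 (left_mem_Icc.2 hT))
  -- Once `|ε| * Z < 1`, the segments from `x t` to `x t + ε • z t` lie in this compact ball, where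
  -- `Df` is uniformly continuous.
  have huc := (isCompact_closedBall (0 : E) (R + 1)).uniformContinuousOn_of_continuous
    (hf.continuous_fderiv one_ne_zero).continuousOn
  have hη' : 0 < η / (Z + 1) := by positivity
  obtain ⟨δ, hδ, huc⟩ := Metric.uniformContinuousOn_iff.1 huc _ hη'
  have hsmall : ∀ᶠ ε : ℝ in 𝓝 0, |ε| * Z < min δ 1 := by
    have hc : Continuous fun ε : ℝ => |ε| * Z := by fun_prop
    refine hc.continuousAt.eventually_lt continuousAt_const ?_
    simp [hδ]
  filter_upwards [hsmall] with ε hε t ht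
  have hmem : ∀ y ∈ closedBall (x t) (|ε| * Z), y ∈ closedBall (0 : E) (R + 1) := fun y hy => by
    rw [mem_closedBall, dist_eq_norm] at hy
    rw [mem_closedBall, dist_zero_right]
    have := norm_le_norm_add_norm_sub' y (x t)
    linarith [hR t ht, min_le_right δ 1]
  have hxm : x t ∈ closedBall (x t) (|ε| * Z) := mem_closedBall_self (by positivity)
  have hεz : ‖ε • z t‖ ≤ |ε| * Z := by
    rw [norm_smul, Real.norm_eq_abs]
    exact mul_le_mul_of_nonneg_left (hZ t ht) (abs_nonneg _)
  have hym : x t + ε • z t ∈ closedBall (x t) (|ε| * Z) := by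
    rw [mem_closedBall, dist_eq_norm, add_sub_cancel_left]
    exact hεz
  have h := (convex_closedBall (x t) (|ε| * Z)).norm_image_sub_le_of_norm_fderiv_le'
    (𝕜 := ℝ) (f := f) (φ := fderiv ℝ f (x t)) (C := η / (Z + 1))
    (fun y _ => hf.differentiable one_ne_zero y)
    (fun y hy => by
      rw [← dist_eq_norm]
      refine (huc y (hmem y hy) (x t) (hmem _ hxm) ?_).le
      rw [mem_closedBall] at hy
      exact hy.trans_lt (hε.trans_le (min_le_left _ _))) hxm hym
  rw [add_sub_cancel_left, map_smul] at h
  refine h.trans ((mul_le_mul_of_nonneg_left hεz hη'.le).trans ?_)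
  have : η / (Z + 1) * (|ε| * Z) = η * |ε| * (Z / (Z + 1)) := by ring
  rw [this]
  refine mul_le_of_le_one_right (by positivity) ?_
  rw [div_le_one (by positivity)]
  linarith

/-- The variation of the end point is the value at time `T` of the solution of the linearized
system. -/
theorem hasDerivAt_endPoint [FiniteDimensional ℝ E] {A : E →L[ℝ] E} {B : E} {f : E → E}
    (hf : ContDiff ℝ 1 f) {K : NNReal} (hK : ∀ u : ℝ, LipschitzWith K (fun x => A x + u • B + f x))
    {T : ℝ} (hT : 0 ≤ T) {w δw : ℝ → ℝ} {x₀ : E} {x z : ℝ → E}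
    (htraj : ∀ ε : ℝ, ∃ y, IsTrajectory (fun x u => A x + u • B + f x) T (w + ε • δw) x₀ y)
    (hx : IsTrajectory (fun x u => A x + u • B + f x) T w x₀ x)
    (hz0 : z 0 = 0)
    (hz : ∀ t ∈ Icc 0 T,
      HasDerivWithinAt z ((A + fderiv ℝ f (x t)) (z t) + δw t • B) (Icc 0 T) t) :
    HasDerivAt (fun ε : ℝ => endPoint (fun x u => A x + u • B + f x) T (w + ε • δw) x₀)
      (z T) 0 := by
  choose y hy using htraj
  have hTm : T ∈ Icc 0 T := right_mem_Icc.2 hT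
  rw [hasDerivAt_iff_isLittleO_nhds_zero, Asymptotics.isLittleO_iff]
  intro c hc
  have hG : 0 ≤ gronwallBound 0 K 1 T := by
    have := gronwallBound_mono (δ := 0) (ε := 1) le_rfl zero_le_one K.coe_nonneg hT
    rwa [gronwallBound_x0] at this
  have hη : 0 < c / (gronwallBound 0 K 1 T + 1) := by positivity
  filter_upwards [eventually_norm_taylor_le hf hT (fun t ht => (hx.2 t ht).continuousWithinAt)
    (fun t ht => (hz t ht).continuousWithinAt) hη] with ε hε
  rw [zero_add, zero_smul, add_zero, endPoint_eq hK hT (hy ε), endPoint_eq hK hT hx]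
  -- The curve `x + ε • z` solves the equation for `w + ε • δw` up to the Taylor remainder of `f`,
  -- which is at most `η|ε|`.
  have h := norm_sub_le_of_approx_solution
    (v := fun t x => A x + (w + ε • δw) t • B + f x) (x := y ε)
    (y := fun t => x t + ε • z t) (fun t _ => hK _)
    (by simp [(hy ε).1, hx.1, hz0]) (hy ε).2
    (fun t ht => (hx.2 t ht).add ((hz t ht).const_smul ε))
    (fun t ht => by
      rw [norm_sub_rev]
      refine le_of_eq_of_le (congrArg norm ?_) (hε t ht)
      change A (x t + ε • z t) + (w t + ε * δw t) • B + f (x t + ε • z t)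
        - (A (x t) + w t • B + f (x t)
          + ε • (A (z t) + fderiv ℝ f (x t) (z t) + δw t • B)) = _
      simp only [map_add, map_smul, add_smul, smul_add, mul_smul]
      abel) T hTm
  rw [sub_sub]
  refine h.trans ?_
  rw [Real.norm_eq_abs]
  have : c / (gronwallBound 0 K 1 T + 1) * |ε| * gronwallBound 0 K 1 T =
    c * |ε| * (gronwallBound 0 K 1 T / (gronwallBound 0 K 1 T + 1)) := by ring
  rw [this]
  refine mul_le_of_le_one_right (by positivity) ?_
  rw [div_le_one (by positivity)]
  linarith

/-- Existence for a non-autonomous inhomogeneous linear equation. -/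
theorem exists_solution_linear [CompleteSpace E] {M : ℝ → E →L[ℝ] E} {g : ℝ → E} {T : ℝ}
    (hT : 0 ≤ T) (hM : ContinuousOn M (Icc 0 T)) (hg : ContinuousOn g (Icc 0 T)) (z₀ : E) :
    ∃ z : ℝ → E, z 0 = z₀ ∧
      ∀ t ∈ Icc 0 T, HasDerivWithinAt z (M t (z t) + g t) (Icc 0 T) t := by
  obtain ⟨C, hC⟩ := isCompact_Icc.exists_bound_of_continuousOn hM
  have hC0 : 0 ≤ C := (norm_nonneg _).trans (hC 0 (left_mem_Icc.2 hT))
  lift C to NNReal using hC0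
  refine exists_solution_Icc (v := fun t x => M t x + g t) (K := C + 0) hT
    (fun t ht => ((M t).lipschitz.weaken (hC t ht)).add (LipschitzWith.const _))
    (fun x => (hM.clm_apply continuousOn_const).add hg) z₀

theorem solution_linear_unique [CompleteSpace E] {M : ℝ → E →L[ℝ] E} {g : ℝ → E} {T : ℝ}
    (hM : ContinuousOn M (Icc 0 T)) {y z : ℝ → E} (hyz : y 0 = z 0)
    (hy : ∀ t ∈ Icc 0 T, HasDerivWithinAt y (M t (y t) + g t) (Icc 0 T) t)
    (hz : ∀ t ∈ Icc 0 T, HasDerivWithinAt z (M t (z t) + g t) (Icc 0 T) t) :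
    ∀ t ∈ Icc 0 T, y t = z t := by
  intro t ht
  obtain ⟨C, hC⟩ := isCompact_Icc.exists_bound_of_continuousOn hM
  have hC0 : 0 ≤ C := (norm_nonneg _).trans (hC t ht)
  lift C to NNReal using hC0
  exact solution_unique_Icc (v := fun t x => M t x + g t) (K := C + 0)
    (fun t ht => ((M t).lipschitz.weaken (hC t ht)).add (LipschitzWith.const _)) hyz hy hz t ht

/-- The end-point map of a linear control system, on controls, as a linear map. -/
theorem exists_linearMap_solution_linear [CompleteSpace E] {M : ℝ → E →L[ℝ] E} (B : E) {T : ℝ}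
    (hT : 0 ≤ T) (hM : ContinuousOn M (Icc 0 T)) :
    ∃ L : smoothControls T →ₗ[ℝ] E, ∀ u : smoothControls T, ∃ z : ℝ → E, z 0 = 0 ∧ z T = L u ∧
      ∀ t ∈ Icc 0 T, HasDerivWithinAt z (M t (z t) + (u : ℝ → ℝ) t • B) (Icc 0 T) t := by
  have hTm : T ∈ Icc 0 T := right_mem_Icc.2 hT
  have hex : ∀ u : smoothControls T, ∃ z : ℝ → E, z 0 = 0 ∧
      ∀ t ∈ Icc 0 T, HasDerivWithinAt z (M t (z t) + (u : ℝ → ℝ) t • B) (Icc 0 T) t := fun u =>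
    exists_solution_linear hT hM
      ((ContDiffOn.continuousOn u.2).smul continuousOn_const) 0
  choose Z hZ0 hZ using hex
  refine ⟨⟨⟨fun u => Z u T, fun u v => ?_⟩, fun a u => ?_⟩, fun u => ⟨Z u, hZ0 u, rfl, hZ u⟩⟩
  · refine solution_linear_unique hM (z := fun t => Z u t + Z v t) (by simp [hZ0]) (hZ (u + v))
      (fun t ht => ((hZ u t ht).add (hZ v t ht)).congr_deriv ?_) T hTm
    simp only [map_add, Submodule.coe_add, Pi.add_apply, add_smul]
    abel
  · refine solution_linear_unique hM (z := fun t => a • Z u t) (by simp [hZ0]) (hZ (a • u))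
      (fun t ht => ((hZ u t ht).const_smul a).congr_deriv ?_) T hTm
    simp [smul_add, mul_smul]

theorem exists_isTrajectory [CompleteSpace E] {A : E →L[ℝ] E} {B : E} {f : E → E} {K : NNReal}
    (hK : ∀ u : ℝ, LipschitzWith K (fun x => A x + u • B + f x)) {T : ℝ} (hT : 0 ≤ T)
    (w : smoothControls T) (x₀ : E) :
    ∃ x, IsTrajectory (fun x u => A x + u • B + f x) T w x₀ x :=
  exists_solution_Icc (v := fun t x => A x + (w : ℝ → ℝ) t • B + f x) hT (fun t _ => hK _)
    (fun _ => (continuousOn_const.add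
      ((ContDiffOn.continuousOn w.2).smul continuousOn_const)).add continuousOn_const) x₀

end Normed

/-- A continuous function orthogonal to all smooth functions on `[0, T]` vanishes there. -/
theorem eqOn_zero_of_integral_smoothControls {g : ℝ → ℝ} {T : ℝ} (hT : 0 < T)
    (hg : ContinuousOn g (Icc 0 T))
    (h : ∀ u : smoothControls T, ∫ t in 0..T, (u : ℝ → ℝ) t * g t = 0) :
    ∀ t ∈ Icc 0 T, g t = 0 := by
  -- Test functions supported in the open interval already give vanishing almost everywhere;
  -- continuity upgrades this to all of `[0, T]`.
  have hae := isOpen_Ioo.ae_eq_zero_of_integral_contDiff_smul_eq_zero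
    (μ := MeasureTheory.volume) (f := g) (U := Ioo 0 T)
    ((hg.mono Ioo_subset_Icc_self).locallyIntegrableOn measurableSet_Ioo)
    (fun u hu _ hsupp => by
      have h1 := h ⟨u, hu.contDiffOn⟩
      rw [intervalIntegral.integral_eq_integral_of_support_subset] at h1
      · exact h1
      · refine (Function.support_mul_subset_left _ _).trans ?_
        exact (subset_tsupport u).trans (hsupp.trans Ioo_subset_Ioc_self))
  have hae' : g =ᵐ[MeasureTheory.volume.restrict (Icc 0 T)] fun _ => 0 := by
    rw [← MeasureTheory.restrict_Ioo_eq_restrict_Icc]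
    exact (MeasureTheory.ae_restrict_iff' measurableSet_Ioo).2 hae
  exact MeasureTheory.Measure.eqOn_Icc_of_ae_eq _ hT.ne hae' hg continuousOn_const

/-! ### Duality with the adjoint equation and surjectivity of the differential. -/

variable {E : Type*} [NormedAddCommGroup E] [InnerProductSpace ℝ E] [FiniteDimensional ℝ E]

open ContinuousLinearMap in
/-- A covector annihilating all end points is propagated by the adjoint equation. -/
theorem exists_adjoint_solution {M : ℝ → E →L[ℝ] E} {B p : E} {T : ℝ} (hT : 0 < T)
    (hM : ContinuousOn M (Icc 0 T))
    (h : ∀ u : smoothControls T, ∃ z : ℝ → E, z 0 = 0 ∧ ⟪p, z T⟫ = 0 ∧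
      ∀ t ∈ Icc 0 T, HasDerivWithinAt z (M t (z t) + (u : ℝ → ℝ) t • B) (Icc 0 T) t) :
    ∃ r : ℝ → E, r 0 = p ∧
      (∀ s ∈ Icc 0 T, HasDerivWithinAt r (adjoint (M (T - s)) (r s)) (Icc 0 T) s) ∧
      ∀ s ∈ Icc 0 T, ⟪B, r s⟫ = 0 := by
  have : CompleteSpace E := FiniteDimensional.complete ℝ E
  have hmaps : MapsTo (fun s : ℝ => T - s) (Icc 0 T) (Icc 0 T) := fun s hs =>
    ⟨by linarith [hs.2], by linarith [hs.1]⟩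
  have hMadj : ContinuousOn (fun s => adjoint (M (T - s))) (Icc 0 T) :=
    (adjoint (𝕜 := ℝ) (E := E) (F := E)).continuous.comp_continuousOn
      (hM.comp (by fun_prop) hmaps)
  obtain ⟨r, hr0, hr⟩ := exists_solution_linear hT.le hMadj (g := fun _ => 0)
    continuousOn_const p
  simp only [add_zero] at hr
  refine ⟨r, hr0, hr, ?_⟩
  have hq : ∀ t ∈ Icc 0 T, HasDerivWithinAt (fun t => r (T - t))
      (-(adjoint (M t) (r (T - t)))) (Icc 0 T) t := fun t ht => by
    have h1 := (hr (T - t) (hmaps ht)).scomp t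
      ((hasDerivWithinAt_id t (Icc 0 T)).const_sub T) hmaps
    rw [neg_one_smul, sub_sub_cancel] at h1
    exact h1
  have hqc : ContinuousOn (fun t => r (T - t)) (Icc 0 T) := fun t ht =>
    (hq t ht).continuousWithinAt
  have hBq := eqOn_zero_of_integral_smoothControls (g := fun t => ⟪r (T - t), B⟫) hT
    (hqc.inner continuousOn_const) (fun u => by
      obtain ⟨z, hz0, hzT, hz⟩ := h u
      -- The terms in `M` cancel by duality. The pairing vanishes at both ends, as `z 0 = 0` and
      -- `⟪p, z T⟫ = 0`, so `u` integrates to zero against `⟪r (T - t), B⟫`.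
      have hd : ∀ t ∈ Icc 0 T, HasDerivWithinAt (fun t => ⟪r (T - t), z t⟫)
          ((u : ℝ → ℝ) t * ⟪r (T - t), B⟫) (Icc 0 T) t := fun t ht => by
        refine ((hq t ht).inner ℝ (hz t ht)).congr_deriv ?_
        rw [inner_add_right, inner_neg_left, adjoint_inner_left, inner_smul_right]
        ring
      rw [intervalIntegral.integral_eq_sub_of_hasDerivAt_of_le hT.le
        (fun t ht => (hd t ht).continuousWithinAt)
        (fun t ht => (hd t (Ioo_subset_Icc_self ht)).hasDerivAt (Icc_mem_nhds ht.1 ht.2))]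
      · simp [hz0, hr0, hzT]
      · refine ContinuousOn.intervalIntegrable ?_
        rw [uIcc_of_le hT.le]
        exact (ContDiffOn.continuousOn u.2).mul (hqc.inner continuousOn_const))
  intro s hs
  have := hBq (T - s) (hmaps hs)
  simp only [sub_sub_cancel] at this
  rw [real_inner_comm]
  exact this

open ContinuousLinearMap in
/-- Local controllability of small perturbations of a linear system satisfying the Kalman
condition. -/
theorem exists_pos_forall_isLocallyControllable {A : E →L[ℝ] E} {B : E}
    (h : ∀ p : E, (∀ j : ℕ, ⟪p, (A ^ j) B⟫ = 0) → p = 0) {T₀ : ℝ} (hT₀ : 0 < T₀) :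
    ∃ κ : ℝ, 0 < κ ∧ ∀ f : E → E, ContDiff ℝ 1 f → (∀ x, ‖fderiv ℝ f x‖ ≤ κ) →
      ∀ T : ℝ, T₀ ≤ T →
        IsLocallyControllable (fun (x : E) (w : ℝ) => A x + w • B + f x) T := by
  have : CompleteSpace E := FiniteDimensional.complete ℝ E
  have hadj : ∀ p : E, (∀ j : ℕ, ⟪B, (adjoint A ^ j) p⟫ = 0) → p = 0 := fun p hp => h p fun j => by
    have h1 := hp j
    rwa [← star_eq_adjoint, ← star_pow, star_eq_adjoint, adjoint_inner_right,
      real_inner_comm] at h1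
  obtain ⟨κ, hκ, huniq⟩ := exists_pos_forall_eq_zero_of_inner_eq_zero hadj hT₀
  refine ⟨κ, hκ, fun f hf hfκ T hT x₀ w => ?_⟩
  have hT0 : 0 < T := hT₀.trans_le hT
  obtain ⟨K, hK⟩ := exists_lipschitzWith_controlSystem A B (hf.differentiable one_ne_zero) hfκ
  obtain ⟨x, hx⟩ := exists_isTrajectory hK hT0.le w x₀
  refine ⟨⟨x, hx⟩, ?_⟩
  have hM : ContinuousOn (fun t => A + fderiv ℝ f (x t)) (Icc 0 T) :=
    continuousOn_const.add ((hf.continuous_fderiv one_ne_zero).comp_continuousOn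
      fun t ht => (hx.2 t ht).continuousWithinAt)
  obtain ⟨L, hL⟩ := exists_linearMap_solution_linear B hT0.le hM
  refine ⟨L, fun δw => ?_, ?_⟩
  · obtain ⟨z, hz0, hzT, hz⟩ := hL δw
    rw [← hzT]
    exact hasDerivAt_endPoint hf hK hT0.le (fun ε => exists_isTrajectory hK hT0.le (w + ε • δw) x₀)
      hx hz0 hz
  -- In finite dimension, surjectivity means that the orthogonal complement of the range is trivial.
  · rw [← LinearMap.range_eq_top, ← Submodule.orthogonal_eq_bot_iff, Submodule.eq_bot_iff]
    intro p hp
    obtain ⟨r, hr0, hr, hBr⟩ := exists_adjoint_solution (p := p) hT0 hM fun u => by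
      obtain ⟨z, hz0, hzT, hz⟩ := hL u
      refine ⟨z, hz0, ?_, hz⟩
      rw [hzT, real_inner_comm]
      exact hp _ (LinearMap.mem_range_self L u)
    have hsub : Icc 0 T₀ ⊆ Icc 0 T := Icc_subset_Icc_right hT
    rw [← hr0]
    refine huniq (fun s => adjoint (fderiv ℝ f (x (T - s)))) r
      (fun s _ => (LinearIsometryEquiv.norm_map adjoint _).trans_le (hfκ _)) (fun s hs => ?_)
      (fun s hs => hBr s (hsub hs))
    have := (hr s (hsub hs)).mono hsub
    rwa [map_add] at this

end Perturbation

theorem mainTheorem3 (n : ℕ)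
    (A : EuclideanSpace ℝ (Fin n) →L[ℝ] EuclideanSpace ℝ (Fin n))
    (B : EuclideanSpace ℝ (Fin n))
    (hAB : IsGloballyControllable (fun (x : EuclideanSpace ℝ (Fin n)) (w : ℝ) => A x + w • B))
    (T₀ : ℝ) (hT₀ : 0 < T₀) :
    ∃ κ : ℝ, 0 < κ ∧
      ∀ f : EuclideanSpace ℝ (Fin n) → EuclideanSpace ℝ (Fin n), ContDiff ℝ ∞ f →
        (∀ x, ‖fderiv ℝ f x‖ < κ) →
          (∀ x, (kalmanMatrix (A + fderiv ℝ f x) B).det ≠ 0) ∧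
          ∀ T : ℝ, T₀ ≤ T →
            IsLocallyControllable
              (fun (x : EuclideanSpace ℝ (Fin n)) (w : ℝ) => A x + w • B + f x) T := by
  have hA := fun p => hAB.eq_zero_of_inner_pow_eq_zero (p := p)
  obtain ⟨κ₁, hκ₁, hloc⟩ := exists_pos_forall_isLocallyControllable hA hT₀
  -- Nonvanishing of the determinant is an open condition that holds at `A`.
  obtain ⟨κ₂, hκ₂, hball⟩ := Metric.isOpen_iff.1
    (isOpen_ne_fun (continuous_kalmanMatrix_det B) continuous_const) A
    (kalmanMatrix_det_ne_zero hA)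
  refine ⟨min κ₁ κ₂, lt_min hκ₁ hκ₂, fun f hf hfκ => ⟨fun x => hball ?_, ?_⟩⟩
  · rw [Metric.mem_ball, dist_eq_norm, add_sub_cancel_left]
    exact (hfκ x).trans_le (min_le_right _ _)
  · exact hloc f (hf.of_le (by exact_mod_cast le_top)) fun x =>
      (hfκ x).le.trans (min_le_left _ _)
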